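/- Let $\Sigma$ and $\Gamma$ be finite alphabets, $\tau:\Gamma\to\Sigma$ a coding, $f:\Gamma\to\Gamma^+$ a morphism (every word $f(b)$ is non-empty), and $a\in\Gamma$, $u\in\Gamma^+$ with $f(a)=au$. Let $f^\infty(a)$ be the limit of the words $f^n(a)$, and let $\sigma=\tau(f^\infty(a))$ be the resulting morphic sequence over $\Sigma$ ($\tau$ is applied elementwise). Consider the signature $\Delta=\Sigma\cup\Gamma\cup\overline\Gamma\cup\{S,E\}$, where $\overline\Gamma=\{\overline b\mid b\in\Gamma\}$ consists of fresh symbols, $S$ and $E$ are fresh, $E$ is a constant and all other symbols are unary. For a word $w=w_0\cdots w_{k-1}$ of unary symbols write $w(t)=w_0(\cdots(w_{k-1}(t))\cdots)$. Let $R_\sigma$ be the rewrite system, acting on finite and infinite terms over $\Delta$, with the rules \[ \begin{array}{rcll} S(b(x)) &\to& \tau(b)(S(\overline b(x))) & \text{for all } b\in\Gamma,\\ \overline b(c(x)) &\to& c(\overline b(x)) & \text{for all } b,c\in\Gamma,\\ \overline b(E) &\to& f(b)(E) & \text{for all } b\in\Gamma. \end{array} \] An infinite reduction $t_0\to t_1\to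 t_2\to\cdots$ converges if for every $n$ only finitely many of its steps take place at level (depth) $\le n$; its limit is then a well-defined term. A sequence over $\Sigma$ is regarded as an infinite term of unary symbols. Then $\sigma$ is the unique infinitary normal form of $\tau(a)(S(u(E)))$ with respect to $R_\sigma$. That is: $\sigma$ is a normal form of $R_\sigma$ (no rule applies to it); there is a converging infinite reduction from $\tau(a)(S(u(E)))$ with limit $\sigma$; every converging infinite reduction from $\tau(a)(S(u(E)))$ has limit $\sigma$; and, more generally, if a normal form $s$ is reached from $\tau(a)(S(u(E)))$ by a strongly convergent reduction of any ordinal length (finite, $\omega$ or longer; at every limit ordinal the levels of the preceding steps tend to infinity and the terms converge to the term at that ordinal), then $s=\sigma$. -/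

import Mathlib

namespace MorphicRewriting

/-! ### Infinite terms over a signature -/

/-- A (finite or infinite) term over a signature with set of symbols `F` and arities `ar`:
a partial map from positions (words over `ℕ`) to symbols that is defined at the root, and is
defined at `p i` iff it is defined at `p` and `i` is smaller than the arity of the symbol there. -/
@[ext]
structure ITerm {F : Type*} (ar : F → ℕ) where
  toFun : List ℕ → Option F
  root : (toFun []).isSome
  child : ∀ (p : List ℕ) (i : ℕ),
    (toFun (p ++ [i])).isSome ↔ ∃ g, toFun p = some g ∧ i < ar g

/-- The term `g(t₀, …, t_{k-1})`, where `k` is the arity of `g`. -/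
def ITerm.app {F : Type*} {ar : F → ℕ} (g : F) (args : Fin (ar g) → ITerm ar) : ITerm ar where
  toFun
    | [] => some g
    | i :: p => if h : i < ar g then (args ⟨i, h⟩).toFun p else none
  root := rfl
  child := by
    intro p i
    cases p with
    | nil =>
      by_cases h : i < ar g
      · simp [h, (args ⟨i, h⟩).root]
      · simp [h]
    | cons j p =>
      by_cases h : j < ar g
      · simpa [h] using (args ⟨j, h⟩).child p i
      · simp [h]

/-- A sequence of unary symbols, seen as an infinite term: the symbol with number `n` is at
position `0ⁿ`. -/
def ITerm.ofSeq {F : Type*} {ar : F → ℕ} (s : ℕ → F) (hs : ∀ n, ar (s n) = 1) : ITerm ar where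
  toFun p := if p = List.replicate p.length 0 then some (s p.length) else none
  root := by simp
  child := by
    intro p i
    by_cases hp : p = List.replicate p.length 0
    · rw [if_pos hp]
      simp only [List.length_append, List.length_singleton, List.replicate_succ']
      by_cases hi : i = 0
      · subst hi
        rw [if_pos (by rw [← hp])]
        simp [hs]
      · have : ¬ (p ++ [i] = List.replicate p.length 0 ++ [0]) := by
          rw [← hp]; simpa using hi
        rw [if_neg this]
        simp [hs, hi]
    · rw [if_neg hp]
      simp only [List.length_append, List.length_singleton, List.replicate_succ']
      have : ¬ (p ++ [i] = List.replicate p.length 0 ++ [0]) := by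
        intro h
        exact hp (List.append_inj_left' h rfl)
      rw [if_neg this]
      simp

/-! ### Finite terms with variables, rewriting -/

/-- Finite terms over the signature `ar` with variables from `X`. -/
inductive FinTerm {F : Type*} (ar : F → ℕ) (X : Type*) where
  | var (x : X) : FinTerm ar X
  | app (g : F) (args : Fin (ar g) → FinTerm ar X) : FinTerm ar X

/-- The instance `tθ` of a finite term under a substitution of (possibly infinite) terms. -/
def FinTerm.subst {F : Type*} {ar : F → ℕ} {X : Type*} (θ : X → ITerm ar) :
    FinTerm ar X → ITerm ar
  | .var x => θ x
  | .app g args => ITerm.app g fun i => (args i).subst θ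

/-- `g(t)` for a unary symbol `g`. -/
def FinTerm.un {F : Type*} {ar : F → ℕ} {X : Type*} (g : F) (t : FinTerm ar X) : FinTerm ar X :=
  .app g fun _ => t

/-- `w(t) = w₀(w₁(⋯(w_{k-1}(t))⋯))` for a word `w` of unary symbols. -/
def FinTerm.word {F : Type*} {ar : F → ℕ} {X : Type*} (w : List F) (t : FinTerm ar X) :
    FinTerm ar X :=
  w.foldr FinTerm.un t

/-- A rewrite system: `R l r` says that `l → r` is a rule. -/
abbrev RewriteSystem {F : Type*} (ar : F → ℕ) (X : Type*) :=
  FinTerm ar X → FinTerm ar X → Prop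

/-- `t` rewrites to `s` by one step at position `p`: for some rule `l → r` and substitution `θ`,
the subterm of `t` at `p` is `lθ`, and `s` is `t` with that subterm replaced by `rθ`.
The level of the step is the length of `p`. -/
def StepAt {F : Type*} {ar : F → ℕ} {X : Type*} (R : RewriteSystem ar X)
    (p : List ℕ) (t s : ITerm ar) : Prop :=
  ∃ (l r : FinTerm ar X) (θ : X → ITerm ar), R l r ∧
    (∀ q, t.toFun (p ++ q) = (l.subst θ).toFun q) ∧
    (∀ q, s.toFun (p ++ q) = (r.subst θ).toFun q) ∧
    (∀ q, ¬ p <+: q → s.toFun q = t.toFun q)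

/-- `t` is a normal form: no rewrite step from `t` is possible. -/
def IsNormalForm {F : Type*} {ar : F → ℕ} {X : Type*} (R : RewriteSystem ar X)
    (t : ITerm ar) : Prop :=
  ∀ p s, ¬ StepAt R p t s

/-- `s` is the limit of a converging infinite reduction `t = T 0 → T 1 → T 2 → ⋯`, in which step
`k` takes place at position `pos k`. Converging: for every `n`, after finitely many steps no step
takes place on level `≤ n` any more. -/
def ConvergesTo {F : Type*} {ar : F → ℕ} {X : Type*} (R : RewriteSystem ar X)
    (t s : ITerm ar) : Prop :=
  ∃ (T : ℕ → ITerm ar) (pos : ℕ → List ℕ),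
    T 0 = t ∧
    (∀ k, StepAt R (pos k) (T k) (T (k + 1))) ∧
    (∀ n, ∃ N, ∀ k, N ≤ k → n < (pos k).length) ∧
    (∀ q, ∃ N, ∀ k, N ≤ k → (T k).toFun q = s.toFun q)

/-- There is a strongly convergent reduction of ordinal length `α` from `t` to `s`: successive
terms are related by rewrite steps, and at every limit ordinal `l ≤ α` the levels of the
steps before `l` tend to infinity and the term with index `l` is the limit of those before. -/
def TransfiniteReduction {F : Type*} {ar : F → ℕ} {X : Type*} (R : RewriteSystem ar X)
    (α : Ordinal.{0}) (t s : ITerm ar) : Prop :=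
  ∃ (T : Ordinal.{0} → ITerm ar) (pos : Ordinal.{0} → List ℕ),
    T 0 = t ∧ T α = s ∧
    (∀ β, β < α → StepAt R (pos β) (T β) (T (Order.succ β))) ∧
    (∀ l, l ≤ α → Order.IsSuccLimit l →
      (∀ n, ∃ β, β < l ∧ ∀ γ, β ≤ γ → γ < l → n < (pos γ).length) ∧
      (∀ q, ∃ β, β < l ∧ ∀ γ, β ≤ γ → γ < l → (T γ).toFun q = (T l).toFun q))

/-! ### Morphic sequences -/

/-- The word `fⁿ(a)`. -/
def iterWord {Γ : Type*} (f : Γ → List Γ) (a : Γ) (n : ℕ) : List Γ :=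
  (fun w : List Γ => w.flatMap f)^[n] [a]

/-- The sequence `f^∞(a)`, the limit of the words `fⁿ(a)`, for non-erasing `f` with `f(a) = au`,
`u` non-empty. In this case `fⁿ(a)` has length greater than `n` and is a prefix of `f^∞(a)`,
see `iterWord_prefix_pureMorphic` below, so that the default value is never used. -/
def pureMorphic {Γ : Type*} (f : Γ → List Γ) (a : Γ) : ℕ → Γ :=
  fun i => (iterWord f a i).getD i a

theorem iterWord_succ {Γ : Type*} (f : Γ → List Γ) (a : Γ) (n : ℕ) :
    iterWord f a (n + 1) = (iterWord f a n).flatMap f := by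
  simp only [iterWord, Function.iterate_succ_apply']

theorem iterWord_succ_prefix {Γ : Type*} (f : Γ → List Γ) (a : Γ) (u : List Γ)
    (hfa : f a = a :: u) (n : ℕ) : iterWord f a n <+: iterWord f a (n + 1) := by
  induction n with
  | zero => exact ⟨u, by simp [iterWord, hfa]⟩
  | succ n ih =>
    obtain ⟨v, hv⟩ := ih
    rw [iterWord_succ f a (n + 1), iterWord_succ f a n]
    refine ⟨v.flatMap f, ?_⟩
    rw [← List.flatMap_append, hv, iterWord_succ]

theorem iterWord_prefix_of_le {Γ : Type*} (f : Γ → List Γ) (a : Γ) (u : List Γ)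
    (hfa : f a = a :: u) {m n : ℕ} (h : m ≤ n) : iterWord f a m <+: iterWord f a n := by
  induction h with
  | refl => exact List.prefix_rfl
  | step _ ih => exact ih.trans (iterWord_succ_prefix f a u hfa _)

theorem length_le_length_flatMap {Γ : Type*} (f : Γ → List Γ) (hf : ∀ b, f b ≠ []) (w : List Γ) :
    w.length ≤ (w.flatMap f).length := by
  induction w with
  | nil => simp
  | cons b w ih =>
    have := List.length_pos_of_ne_nil (hf b)
    simp only [List.flatMap_cons, List.length_append, List.length_cons]
    omega

theorem lt_length_iterWord {Γ : Type*} (f : Γ → List Γ) (hf : ∀ b, f b ≠ []) (a : Γ) (u : List Γ)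
    (hu : u ≠ []) (hfa : f a = a :: u) (n : ℕ) : n < (iterWord f a n).length := by
  induction n with
  | zero => simp [iterWord]
  | succ n ih =>
    have h0 : iterWord f a 0 <+: iterWord f a n := iterWord_prefix_of_le f a u hfa (Nat.zero_le n)
    obtain ⟨v, hv⟩ := h0
    have hv1 : iterWord f a n = a :: v := by rw [← hv]; simp [iterWord]
    have h1 := length_le_length_flatMap f hf v
    have h2 := List.length_pos_of_ne_nil hu
    rw [hv1] at ih
    rw [iterWord_succ, hv1]
    simp only [List.flatMap_cons, hfa, List.length_append, List.length_cons] at ih ⊢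
    omega

/-- Every word `fⁿ(a)` is a prefix of the sequence `f^∞(a)`. -/
theorem iterWord_prefix_pureMorphic {Γ : Type*} (f : Γ → List Γ) (hf : ∀ b, f b ≠ []) (a : Γ)
    (u : List Γ) (hu : u ≠ []) (hfa : f a = a :: u) (n i : ℕ)
    (hi : i < (iterWord f a n).length) : (iterWord f a n)[i] = pureMorphic f a i := by
  have hj := lt_length_iterWord f hf a u hu hfa i
  rw [pureMorphic, List.getD_eq_getElem _ _ hj]
  rcases le_total n i with h | h
  · exact (iterWord_prefix_of_le f a u hfa h).getElem hi
  · exact ((iterWord_prefix_of_le f a u hfa h).getElem hj).symm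

/-! ### The rewrite system of a morphic sequence -/

/-- The signature `Δ = Σ ∪ Γ ∪ Γ̄ ∪ {S, E}`, for alphabets `Sg` (that is, `Σ`) and `Γ` which
may have letters in common. -/
inductive Sym {A : Type*} (Sg Γ : Set A) where
  | letter (x : (Sg ∪ Γ : Set A)) : Sym Sg Γ
  | bar (b : Γ) : Sym Sg Γ
  | S : Sym Sg Γ
  | E : Sym Sg Γ

/-- `E` is a constant, all other symbols are unary. -/
def Sym.ar {A : Type*} {Sg Γ : Set A} : Sym Sg Γ → ℕ
  | .letter _ => 1
  | .bar _ => 1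
  | .S => 1
  | .E => 0

/-- A letter of `Σ` as a symbol of `Δ`. -/
def Sym.out {A : Type*} {Sg Γ : Set A} (x : Sg) : Sym Sg Γ := .letter ⟨x, Or.inl x.2⟩

/-- A letter of `Γ` as a symbol of `Δ`. -/
def Sym.inp {A : Type*} {Sg Γ : Set A} (b : Γ) : Sym Sg Γ := .letter ⟨b, Or.inr b.2⟩

/-- Finite terms over `Δ`. -/
abbrev Tm {A : Type*} (Sg Γ : Set A) (X : Type) := FinTerm (Sym.ar (Sg := Sg) (Γ := Γ)) X

/-- The constant `E` as a term. -/
def endTerm {A : Type*} (Sg Γ : Set A) (X : Type) : Tm Sg Γ X :=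
  .app Sym.E (fun i => Fin.elim0 i)

/-- The rewrite system of `τ(f^∞(a))`; its only variable is `x = .var ()`. -/
inductive Rules {A : Type*} {Sg Γ : Set A} (f : Γ → List Γ) (τ : Γ → Sg) :
    RewriteSystem (Sym.ar (Sg := Sg) (Γ := Γ)) Unit
  /-- `S(b(x)) → τ(b)(S(b̄(x)))` -/
  | emit (b : Γ) : Rules f τ
      (.un Sym.S (.un (Sym.inp b) (.var ())))
      (.un (Sym.out (τ b)) (.un Sym.S (.un (Sym.bar b) (.var ()))))
  /-- `b̄(c(x)) → c(b̄(x))` -/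
  | swap (b c : Γ) : Rules f τ
      (.un (Sym.bar b) (.un (Sym.inp c) (.var ())))
      (.un (Sym.inp c) (.un (Sym.bar b) (.var ())))
  /-- `b̄(E) → f(b)(E)` -/
  | expand (b : Γ) : Rules f τ
      (.un (Sym.bar b) (endTerm Sg Γ Unit))
      (.word ((f b).map Sym.inp) (endTerm Sg Γ Unit))

/-- The term `τ(a)(S(u(E)))`. -/
def startTerm {A : Type*} {Sg Γ : Set A} (τ : Γ → Sg) (a : Γ) (u : List Γ) :
    ITerm (Sym.ar (Sg := Sg) (Γ := Γ)) :=
  FinTerm.subst Empty.elim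
    (.un (Sym.out (τ a)) (.un Sym.S (.word (u.map Sym.inp) (endTerm Sg Γ Empty))))

/-- A sequence over `Σ` as an infinite term over `Δ`. -/
def seqTerm {A : Type*} {Sg : Set A} (Γ : Set A) (σ : ℕ → Sg) :
    ITerm (Sym.ar (Sg := Sg) (Γ := Γ)) :=
  ITerm.ofSeq (fun n => Sym.out (σ n)) (fun _ => rfl)

end MorphicRewriting

/-! Write `c` for the sequence `pureMorphic f a`. Every term reached after finitely many steps is a
word `τ(c₀) ⋯ τ(c_{k-1}) S v E` with `v` over plain and barred letters. Let `evalWord f v` be the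
word left when every bar has travelled to `E` and been expanded. The invariant `Valid` says that `c₀
⋯ c_{k-1} · evalWord f v = f(c₀ ⋯ c_{k-1})`: what lies behind `S` is the part of the image that has
not yet been emitted.

The invariant gives three facts. The emitted letter is always the right one
(`eq_pureMorphic_of_prefix`), because `f` maps prefixes of `c` to prefixes of `c`. Reduction is
never stuck (`Valid.exists_stateStep`), because the image of `k > 0` letters has more than `k`
letters. The levels available while `k` letters are out are bounded in terms of `k`
(`Valid.level_lt`).

By the last fact a converging reduction must emit infinitely often, so its limit is `σ`
(`ConvergesTo.eq_seqTerm`). Conversely, `potential` drops at each step that emits nothing, so every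
infinite sequence of state steps emits infinitely often; as no step takes place above level `k`, it
converges (`exists_fst_gt`, `convergesTo_seqTerm`). A transfinite reduction to a normal form cannot
be finite, reaches `σ` at `ω`, and stops there. -/

namespace MorphicRewriting

/-! ### Words as terms -/

/-- The labelled positions of a word `w₀ w₁ ⋯`: the symbol with number `n` is at position `0ⁿ`. -/
def wordFun {F : Type*} : List F → List ℕ → Option F
  | [], _ => none
  | x :: _, [] => some x
  | _ :: w, i :: q => if i = 0 then wordFun w q else none

section Words

variable {F : Type*}

@[simp] theorem wordFun_nil_left (q : List ℕ) : wordFun ([] : List F) q = none := by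
  cases q <;> rfl

@[simp] theorem wordFun_cons_nil (x : F) (w : List F) : wordFun (x :: w) [] = some x := rfl

@[simp] theorem wordFun_cons_cons (x : F) (w : List F) (i : ℕ) (q : List ℕ) :
    wordFun (x :: w) (i :: q) = if i = 0 then wordFun w q else none := rfl

theorem wordFun_append (w v : List F) (q : List ℕ) :
    wordFun (w ++ v) (List.replicate w.length 0 ++ q) = wordFun v q := by
  induction w with
  | nil => rfl
  | cons x w ih => simpa [List.replicate_succ] using ih

theorem wordFun_append_of_not_prefix (w v v' : List F) (q : List ℕ)
    (hq : ¬ List.replicate w.length 0 <+: q) : wordFun (w ++ v) q = wordFun (w ++ v') q := by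
  induction w generalizing q with
  | nil => simp at hq
  | cons x w ih =>
    cases q with
    | nil => rfl
    | cons i q =>
      by_cases hi : i = 0
      · subst hi
        simpa using ih q (by simpa [List.replicate_succ, List.cons_prefix_cons] using hq)
      · simp [hi]

theorem exists_eq_append_of_wordFun_eq_some {w : List F} {p : List ℕ} {g : F}
    (h : wordFun w p = some g) :
    ∃ w₁ v, w = w₁ ++ g :: v ∧ p = List.replicate w₁.length 0 := by
  induction w generalizing p with
  | nil => simp at h
  | cons x w ih =>
    cases p with
    | nil => exact ⟨[], w, by simpa using h, rfl⟩
    | cons i p =>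
      by_cases hi : i = 0
      · obtain ⟨w₁, v, rfl, rfl⟩ := ih (p := p) (by simpa [hi] using h)
        exact ⟨x :: w₁, v, rfl, by simp [hi, List.replicate_succ]⟩
      · simp [hi] at h

theorem wordFun_eq_ite (w : List F) (q : List ℕ) :
    wordFun w q = if q = List.replicate q.length 0 then w[q.length]? else none := by
  induction w generalizing q with
  | nil => simp
  | cons x w ih =>
    cases q with
    | nil => rfl
    | cons i q =>
      by_cases hi : i = 0
      · simp [hi, ih q, List.replicate_succ]
      · simp [hi, List.replicate_succ]

theorem wordFun_nil_right_eq_some {w : List F} {g : F} (h : wordFun w [] = some g) :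
    ∃ v, w = g :: v := by
  cases w with
  | nil => simp at h
  | cons x w => exact ⟨w, by simpa using h⟩

theorem wordFun_nil_right_eq_none {w : List F} (h : wordFun w [] = none) : w = [] := by
  cases w with
  | nil => rfl
  | cons x w => simp at h

end Words

theorem ITerm.app_nil {F : Type*} {ar : F → ℕ} (g : F) (args : Fin (ar g) → ITerm ar) :
    (ITerm.app g args).toFun [] = some g := rfl

theorem ITerm.app_cons {F : Type*} {ar : F → ℕ} (g : F) (args : Fin (ar g) → ITerm ar)
    (i : ℕ) (p : List ℕ) : (ITerm.app g args).toFun (i :: p) =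
      if h : i < ar g then (args ⟨i, h⟩).toFun p else none := rfl

theorem subst_un_toFun {F X : Type*} {ar : F → ℕ} {θ : X → ITerm ar} {g : F} {t : FinTerm ar X}
    {w : List F} (h : (t.subst θ).toFun = wordFun w) (hg : ar g = 1 := by rfl) :
    ((FinTerm.un g t).subst θ).toFun = wordFun (g :: w) := by
  funext q
  cases q with
  | nil => rfl
  | cons i q =>
    simp only [FinTerm.un, FinTerm.subst, ITerm.app_cons, hg, Nat.lt_one_iff, wordFun_cons_cons, h]
    split <;> rfl

theorem subst_word_toFun {F X : Type*} {ar : F → ℕ} {θ : X → ITerm ar} {v : List F}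
    (hv : ∀ g ∈ v, ar g = 1) {t : FinTerm ar X} {w : List F}
    (h : (t.subst θ).toFun = wordFun w) :
    ((FinTerm.word v t).subst θ).toFun = wordFun (v ++ w) := by
  induction v with
  | nil => exact h
  | cons x v ih =>
    exact subst_un_toFun (ih fun g hg => hv g (by simp [hg])) (hv x (by simp))

/-- The subterm at a position. -/
def ITerm.subterm {F : Type*} {ar : F → ℕ} (t : ITerm ar) (p : List ℕ)
    (h : (t.toFun p).isSome) : ITerm ar where
  toFun q := t.toFun (p ++ q)
  root := by simpa using h
  child q i := by simpa using t.child (p ++ q) i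

/-- A substitution must assign a genuine term, and not every word is one (the arities must fit). The
tail of a word that is a term is one, namely a subterm. -/
theorem exists_toFun_eq_tail {F : Type*} {ar : F → ℕ} {t : ITerm ar} {w v : List F} {x : F}
    (hx : ar x = 1) (ht : t.toFun = wordFun (w ++ x :: v)) :
    ∃ t' : ITerm ar, t'.toFun = wordFun v := by
  have h : (t.toFun (List.replicate w.length 0 ++ [0])).isSome := by
    refine (t.child _ _).2 ⟨x, ?_, by simp [hx]⟩
    simpa [ht] using wordFun_append w (x :: v) []
  refine ⟨t.subterm _ h, funext fun q => ?_⟩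
  simpa [ITerm.subterm, ht] using wordFun_append w (x :: v) (0 :: q)

section Morphic

variable {A : Type*} {Sg Γ : Set A}

theorem subst_endTerm_toFun {X : Type} (θ : X → ITerm (Sym.ar (Sg := Sg) (Γ := Γ))) :
    ((endTerm Sg Γ X).subst θ).toFun = wordFun [Sym.E] := by
  funext q
  cases q with
  | nil => rfl
  | cons i q =>
    rw [wordFun_cons_cons, wordFun_nil_left, ite_self, endTerm, FinTerm.subst, ITerm.app_cons]
    exact dif_neg (show ¬ i < Sym.ar (Sym.E : Sym Sg Γ) from Nat.not_lt_zero i)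

theorem inp_injective : Function.Injective (Sym.inp (Sg := Sg) (Γ := Γ)) := by
  intro b c h
  simp only [Sym.inp, Sym.letter.injEq] at h
  exact Subtype.ext (Subtype.mk.inj h)

theorem ar_of_mem_map_inp {v : List Γ} :
    ∀ g ∈ v.map (Sym.inp (Sg := Sg)), Sym.ar g = 1 := by
  intro g hg
  obtain ⟨b, -, rfl⟩ := List.mem_map.1 hg
  rfl

/-! ### Steps on words -/

/-- The rewrite rules as a relation between words, the variable standing for a word. -/
inductive WordRule (f : Γ → List Γ) (τ : Γ → Sg) : List (Sym Sg Γ) → List (Sym Sg Γ) → Prop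
  | emit (b : Γ) (v) : WordRule f τ (Sym.S :: Sym.inp b :: v)
      (Sym.out (τ b) :: Sym.S :: Sym.bar b :: v)
  | swap (b c : Γ) (v) : WordRule f τ (Sym.bar b :: Sym.inp c :: v)
      (Sym.inp c :: Sym.bar b :: v)
  | expand (b : Γ) : WordRule f τ [Sym.bar b, Sym.E] ((f b).map Sym.inp ++ [Sym.E])

theorem StepAt.exists_wordRule {f : Γ → List Γ} {τ : Γ → Sg} {p : List ℕ}
    {t s : ITerm (Sym.ar (Sg := Sg) (Γ := Γ))} (h : StepAt (Rules f τ) p t s)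
    {w : List (Sym Sg Γ)} (ht : t.toFun = wordFun w) :
    ∃ w₁ v v', w = w₁ ++ v ∧ p = List.replicate w₁.length 0 ∧ WordRule f τ v v' ∧
      s.toFun = wordFun (w₁ ++ v') := by
  obtain ⟨l, r, θ, hR, hl, hr, hs⟩ := h
  suffices ∃ w₁ v v', w = w₁ ++ v ∧ p = List.replicate w₁.length 0 ∧ WordRule f τ v v' ∧
      (r.subst θ).toFun = wordFun v' by
    obtain ⟨w₁, v, v', hw, hp, hv, hrv⟩ := this
    refine ⟨w₁, v, v', hw, hp, hv, ?_⟩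
    funext q
    by_cases hq : p <+: q
    · obtain ⟨q, rfl⟩ := hq
      rw [hr, hrv, hp, wordFun_append]
    · rw [hs q hq, ht, hw]
      exact wordFun_append_of_not_prefix _ _ _ _ (hp ▸ hq)
  -- The root symbol of the redex fixes where `w` splits; comparing deeper positions then recovers
  -- the rest of the left-hand side and the value of the variable.
  have key : ∀ g, (l.subst θ).toFun [] = some g → ∃ w₁ v, w = w₁ ++ g :: v ∧
      p = List.replicate w₁.length 0 ∧ ∀ q, wordFun v q = (l.subst θ).toFun (0 :: q) := by
    intro g hg
    have h0 := hl []
    rw [List.append_nil, hg, ht] at h0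
    obtain ⟨w₁, v, rfl, rfl⟩ := exists_eq_append_of_wordFun_eq_some h0
    refine ⟨w₁, v, rfl, rfl, fun q => ?_⟩
    rw [← hl, ht, wordFun_append]
    simp
  cases hR with
  | emit b =>
    obtain ⟨w₁, v, hw, hp, hv⟩ := key Sym.S rfl
    obtain ⟨v, rfl⟩ := wordFun_nil_right_eq_some (hv [])
    have hθ : ((FinTerm.var ()).subst θ).toFun = wordFun v :=
      funext fun q => (hv (0 :: q)).symm
    exact ⟨w₁, _, _, hw, hp, .emit b v, subst_un_toFun <|
      subst_un_toFun <| subst_un_toFun hθ⟩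
  | swap b c =>
    obtain ⟨w₁, v, hw, hp, hv⟩ := key (Sym.bar b) rfl
    obtain ⟨v, rfl⟩ := wordFun_nil_right_eq_some (hv [])
    have hθ : ((FinTerm.var ()).subst θ).toFun = wordFun v :=
      funext fun q => (hv (0 :: q)).symm
    exact ⟨w₁, _, _, hw, hp, .swap b c v, subst_un_toFun <|
      subst_un_toFun hθ⟩
  | expand b =>
    obtain ⟨w₁, v, hw, hp, hv⟩ := key (Sym.bar b) rfl
    obtain ⟨v, rfl⟩ := wordFun_nil_right_eq_some (hv [])
    -- The position below the constant `E` is undefined, so nothing follows `E`.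
    obtain rfl : v = [] := wordFun_nil_right_eq_none (hv [0])
    exact ⟨w₁, _, _, hw, hp, .expand b, subst_word_toFun
      ar_of_mem_map_inp (subst_endTerm_toFun θ)⟩

theorem WordRule.stepAt {f : Γ → List Γ} {τ : Γ → Sg} {v v' : List (Sym Sg Γ)}
    (h : WordRule f τ v v') (w : List (Sym Sg Γ)) {t s : ITerm (Sym.ar (Sg := Sg) (Γ := Γ))}
    (ht : t.toFun = wordFun (w ++ v)) (hs : s.toFun = wordFun (w ++ v')) :
    StepAt (Rules f τ) (List.replicate w.length 0) t s := by
  suffices ∃ l r θ, Rules f τ l r ∧ (l.subst θ).toFun = wordFun v ∧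
      (r.subst θ).toFun = wordFun v' by
    obtain ⟨l, r, θ, hR, hl, hr⟩ := this
    refine ⟨l, r, θ, hR, fun q => ?_, fun q => ?_, fun q hq => ?_⟩
    · rw [ht, hl, wordFun_append]
    · rw [hs, hr, wordFun_append]
    · rw [ht, hs]
      exact wordFun_append_of_not_prefix _ _ _ _ hq
  cases h with
  | emit b v =>
    obtain ⟨t', h'⟩ := exists_toFun_eq_tail (t := t) (w := w ++ [Sym.S]) (x := Sym.inp b) (v := v)
      rfl (by simpa using ht)
    have h' : ((FinTerm.var ()).subst fun _ => t').toFun = wordFun v := h'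
    exact ⟨_, _, fun _ => t', .emit b, subst_un_toFun <| subst_un_toFun h',
      subst_un_toFun <| subst_un_toFun <| subst_un_toFun h'⟩
  | swap b c v =>
    obtain ⟨t', h'⟩ := exists_toFun_eq_tail (t := t) (w := w ++ [Sym.bar b]) (x := Sym.inp c)
      (v := v) rfl (by simpa using ht)
    have h' : ((FinTerm.var ()).subst fun _ => t').toFun = wordFun v := h'
    exact ⟨_, _, fun _ => t', .swap b c, subst_un_toFun <| subst_un_toFun h',
      subst_un_toFun <| subst_un_toFun h'⟩
  | expand b =>
    exact ⟨_, _, fun _ => t, .expand b, subst_un_toFun (subst_endTerm_toFun _),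
      subst_word_toFun ar_of_mem_map_inp (subst_endTerm_toFun _)⟩

/-! ### Abstract states -/

/-- The symbol of `Γ ∪ Γ̄` given by a letter of `Γ` (`inl`) or a barred letter (`inr`). -/
def innerSym : Γ ⊕ Γ → Sym Sg Γ := Sum.elim Sym.inp Sym.bar

/-- The word `τ(c₀) ⋯ τ(c_{k-1}) S v E` described by a pair `(k, v)`. -/
def stateWord (τ : Γ → Sg) (c : ℕ → Γ) (x : ℕ × List (Γ ⊕ Γ)) : List (Sym Sg Γ) :=
  (List.range x.1).map (fun i => Sym.out (τ (c i))) ++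
    Sym.S :: (x.2.map innerSym ++ [Sym.E])

/-- The word of letters that is left when all barred letters have been moved to the end and
expanded. -/
def evalWord (f : Γ → List Γ) : List (Γ ⊕ Γ) → List Γ
  | [] => []
  | .inl b :: v => b :: evalWord f v
  | .inr b :: v => evalWord f v ++ f b

/-- The invariant `c₀ ⋯ c_{k-1} · eval v = f(c₀ ⋯ c_{k-1})` with `k > 0`. -/
def Valid (f : Γ → List Γ) (c : ℕ → Γ) (x : ℕ × List (Γ ⊕ Γ)) : Prop :=
  0 < x.1 ∧ (List.range x.1).map c ++ evalWord f x.2 = ((List.range x.1).map c).flatMap f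

/-- Rewrite steps on states, with their levels. -/
inductive StateStep (f : Γ → List Γ) (c : ℕ → Γ) :
    ℕ → ℕ × List (Γ ⊕ Γ) → ℕ × List (Γ ⊕ Γ) → Prop
  | emit (k v) : StateStep f c k (k, .inl (c k) :: v) (k + 1, .inr (c k) :: v)
  | swap (k v w b d) : StateStep f c (k + 1 + v.length)
      (k, v ++ .inr b :: .inl d :: w) (k, v ++ .inl d :: .inr b :: w)
  | expand (k v b) : StateStep f c (k + 1 + v.length)
      (k, v ++ [.inr b]) (k, v ++ (f b).map .inl)

variable {f : Γ → List Γ} {τ : Γ → Sg} {c : ℕ → Γ}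

/-! ### Preservation of the invariant and the termination measure -/

theorem evalWord_map_inl (w : List Γ) : evalWord f (w.map .inl) = w := by
  induction w with
  | nil => rfl
  | cons b w ih => simp [evalWord, ih]

/-- Evaluation recurses from the right and sees a suffix only through its value. Hence swaps and
expansions need to be checked only at the redex. -/
theorem evalWord_append_congr (v : List (Γ ⊕ Γ)) {w w' : List (Γ ⊕ Γ)}
    (h : evalWord f w = evalWord f w') : evalWord f (v ++ w) = evalWord f (v ++ w') := by
  induction v with
  | nil => exact h
  | cons x v ih => cases x <;> simp [evalWord, ih]

theorem length_le_length_evalWord (hf : ∀ b, f b ≠ []) (v : List (Γ ⊕ Γ)) :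
    v.length ≤ (evalWord f v).length := by
  induction v with
  | nil => simp
  | cons x v ih =>
    cases x with
    | inl b => simpa [evalWord] using ih
    | inr b =>
      have := List.length_pos_of_ne_nil (hf b)
      simp only [evalWord, List.length_cons, List.length_append]
      omega

/-- The number of swaps and expansions that are possible before the next emission. -/
def potential (f : Γ → List Γ) : List (Γ ⊕ Γ) → ℕ
  | [] => 0
  | .inl _ :: v => potential f v
  | .inr _ :: v => potential f v + (evalWord f v).length + 1

theorem potential_map_inl (w : List Γ) : potential f (w.map .inl) = 0 := by
  induction w with
  | nil => rfl
  | cons b w ih => simpa [potential] using ih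

/-- A bar in `v` contributes one swap for each letter of the evaluation to its right, plus its
expansion. Equal evaluations keep these contributions unchanged, so only the suffix matters. -/
theorem potential_append_lt (v : List (Γ ⊕ Γ)) {w w' : List (Γ ⊕ Γ)}
    (h : evalWord f w = evalWord f w') (hlt : potential f w < potential f w') :
    potential f (v ++ w) < potential f (v ++ w') := by
  induction v with
  | nil => exact hlt
  | cons x v ih =>
    cases x with
    | inl b => simpa [potential] using ih
    | inr b => simpa [potential, evalWord_append_congr v h] using ih

/-- An emission moves `c k` from the evaluation to the emitted prefix and appends `f (c k)` to both
sides of the invariant; the other two steps do not change the evaluation. -/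
theorem StateStep.valid {n : ℕ} {x y : ℕ × List (Γ ⊕ Γ)} (h : StateStep f c n x y)
    (hx : Valid f c x) : Valid f c y := by
  obtain ⟨h0, hx⟩ := hx
  cases h with
  | emit k v =>
    refine ⟨Nat.succ_pos _, ?_⟩
    simp only [evalWord] at hx
    simp [List.range_succ, evalWord, ← hx]
  | swap k v w b d =>
    refine ⟨h0, ?_⟩
    rw [← hx]
    exact congrArg _ (evalWord_append_congr v (by simp [evalWord]))
  | expand k v b =>
    refine ⟨h0, ?_⟩
    rw [← hx]
    exact congrArg _ (evalWord_append_congr v (by simp [evalWord, evalWord_map_inl]))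

theorem StateStep.le_level {n : ℕ} {x y : ℕ × List (Γ ⊕ Γ)} (h : StateStep f c n x y) :
    x.1 ≤ n := by
  cases h <;> simp only <;> omega

theorem StateStep.fst_le {n : ℕ} {x y : ℕ × List (Γ ⊕ Γ)} (h : StateStep f c n x y) :
    x.1 ≤ y.1 := by
  cases h <;> simp

theorem StateStep.potential_lt {n : ℕ} {x y : ℕ × List (Γ ⊕ Γ)} (h : StateStep f c n x y)
    (hxy : x.1 = y.1) : potential f y.2 < potential f x.2 := by
  cases h with
  | emit k v => simp at hxy
  | swap k v w b d => exact potential_append_lt v (by simp [evalWord]) (by simp [potential, evalWord])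
  | expand k v b =>
    exact potential_append_lt v (by simp [evalWord, evalWord_map_inl])
      (by simp [potential, potential_map_inl])

theorem StateStep.level_lt {n : ℕ} {x y : ℕ × List (Γ ⊕ Γ)} (h : StateStep f c n x y) :
    n < x.1 + 1 + x.2.length := by
  cases h <;> simp
  omega

theorem StateStep.exists_wordRule {n : ℕ} {x y : ℕ × List (Γ ⊕ Γ)} (h : StateStep f c n x y) :
    ∃ w v v' : List (Sym Sg Γ), WordRule f τ v v' ∧ n = w.length ∧
      stateWord τ c x = w ++ v ∧ stateWord τ c y = w ++ v' := by
  cases h with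
  | emit _ v =>
    exact ⟨(List.range n).map (fun i => Sym.out (τ (c i))), _, _, .emit (c n) (v.map innerSym ++ [Sym.E]), by simp,
      by simp [stateWord, innerSym], by simp [stateWord, innerSym, List.range_succ]⟩
  | swap k v w b d =>
    exact ⟨(List.range k).map (fun i => Sym.out (τ (c i))) ++ Sym.S :: v.map innerSym, _, _,
      .swap b d (w.map innerSym ++ [Sym.E]), by simp; omega,
      by simp [stateWord, innerSym], by simp [stateWord, innerSym]⟩
  | expand k v b =>
    exact ⟨(List.range k).map (fun i => Sym.out (τ (c i))) ++ Sym.S :: v.map innerSym, _, _,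
      .expand b, by simp; omega,
      by simp [stateWord, innerSym], by simp [stateWord, innerSym, Function.comp_def]⟩

/-! ### Morphic sequences -/

theorem map_range_pureMorphic (hf : ∀ b, f b ≠ []) {a : Γ} {u : List Γ} (hu : u ≠ [])
    (hfa : f a = a :: u) (k : ℕ) :
    (List.range k).map (pureMorphic f a) <+: iterWord f a k := by
  have hk := lt_length_iterWord f hf a u hu hfa k
  rw [List.prefix_iff_eq_take]
  refine List.ext_getElem (by simp; omega) fun i hi hi' => ?_
  simp [iterWord_prefix_pureMorphic f hf a u hu hfa]

/-- The first `k` letters of the sequence form a prefix of `fᵏ(a)`, so their image is a prefix of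
`fᵏ⁺¹(a)`, itself a prefix of the sequence; `b` is its letter number `k`. -/
theorem eq_pureMorphic_of_prefix (hf : ∀ b, f b ≠ []) {a : Γ} {u : List Γ} (hu : u ≠ [])
    (hfa : f a = a :: u) {k : ℕ} {b : Γ} {v : List Γ}
    (h : (List.range k).map (pureMorphic f a) ++ b :: v =
      ((List.range k).map (pureMorphic f a)).flatMap f) : b = pureMorphic f a k := by
  obtain ⟨w, hw⟩ := map_range_pureMorphic hf hu hfa k
  have h1 : iterWord f a (k + 1) =
      (List.range k).map (pureMorphic f a) ++ b :: (v ++ w.flatMap f) := by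
    rw [iterWord_succ, ← hw, List.flatMap_append, ← h]
    simp
  have hk : k < (iterWord f a (k + 1)).length := by simp [h1]
  rw [← iterWord_prefix_pureMorphic f hf a u hu hfa (k + 1) k hk]
  simp [h1]

theorem pureMorphic_zero (f : Γ → List Γ) (a : Γ) : pureMorphic f a 0 = a := by
  simp [pureMorphic, iterWord]

theorem length_lt_length_flatMap (hf : ∀ b, f b ≠ []) {a : Γ} {u : List Γ} (hu : u ≠ [])
    (hfa : f a = a :: u) {k : ℕ} (hk : 0 < k) :
    k < (((List.range k).map (pureMorphic f a)).flatMap f).length := by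
  obtain ⟨k, rfl⟩ := Nat.exists_eq_succ_of_ne_zero hk.ne'
  have h1 := length_le_length_flatMap f hf
    (((List.range k).map Nat.succ).map (pureMorphic f a))
  have h2 := List.length_pos_of_ne_nil hu
  -- Split off the initial letter `a`: its image `au` has at least two letters, and every other
  -- image has at least one.
  rw [Nat.succ_eq_add_one, List.range_succ_eq_map]
  simp only [List.map_cons, List.flatMap_cons, pureMorphic_zero, hfa, List.length_append,
    List.length_cons, List.length_map, List.length_range] at h1 ⊢
  omega

theorem Valid.snd_ne_nil (hf : ∀ b, f b ≠ []) {a : Γ} {u : List Γ} (hu : u ≠ [])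
    (hfa : f a = a :: u) {x : ℕ × List (Γ ⊕ Γ)} (hx : Valid f (pureMorphic f a) x) :
    x.2 ≠ [] := by
  intro h
  have h1 := length_lt_length_flatMap hf hu hfa hx.1
  rw [← hx.2, h] at h1
  simp [evalWord] at h1

/-- As `f` is non-erasing, `v` is no longer than its evaluation, whose length the invariant
determines. The resulting bound depends on `x.1` alone. -/
theorem Valid.level_lt (hf : ∀ b, f b ≠ []) {x y : ℕ × List (Γ ⊕ Γ)} (hx : Valid f c x) {n : ℕ}
    (h : StateStep f c n x y) : n < (((List.range x.1).map c).flatMap f).length + 1 := by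
  have h1 := h.level_lt
  have h2 := length_le_length_evalWord hf x.2
  rw [← hx.2]
  simp only [List.length_append, List.length_map, List.length_range]
  omega

theorem length_flatMap_range_mono {k l : ℕ} (h : k ≤ l) :
    (((List.range k).map c).flatMap f).length ≤ (((List.range l).map c).flatMap f).length := by
  obtain ⟨m, rfl⟩ := Nat.exists_eq_add_of_le h
  simp [List.range_add]

/-- The last bar of a run of consecutive bars has a plain letter or `E` to its right, so it can move
or expand. -/
theorem exists_stateStep_of_inr (k : ℕ) (v : List (Γ ⊕ Γ)) (b : Γ) (w : List (Γ ⊕ Γ)) :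
    ∃ n y, StateStep f c n (k, v ++ .inr b :: w) y := by
  induction w generalizing v b with
  | nil => exact ⟨_, _, .expand k v b⟩
  | cons d w ih =>
    cases d with
    | inl d => exact ⟨_, _, .swap k v w b d⟩
    | inr d =>
      rw [List.append_cons]
      exact ih (v ++ [.inr b]) d

theorem Valid.exists_stateStep (hf : ∀ b, f b ≠ []) {a : Γ} {u : List Γ} (hu : u ≠ [])
    (hfa : f a = a :: u) {x : ℕ × List (Γ ⊕ Γ)} (hx : Valid f (pureMorphic f a) x) :
    ∃ n y, StateStep f (pureMorphic f a) n x y := by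
  have h1 := hx.snd_ne_nil hf hu hfa
  obtain ⟨k, v⟩ := x
  cases v with
  | nil => simp at h1
  | cons d v =>
    cases d with
    | inl d =>
      obtain rfl : d = pureMorphic f a k := eq_pureMorphic_of_prefix hf hu hfa hx.2
      exact ⟨_, _, .emit k v⟩
    | inr d => exact exists_stateStep_of_inr k [] d v

/-! ### Steps from terms that represent states -/

theorem exists_iTerm_stateWord (τ : Γ → Sg) (c : ℕ → Γ) (x : ℕ × List (Γ ⊕ Γ)) :
    ∃ t : ITerm (Sym.ar (Sg := Sg) (Γ := Γ)), t.toFun = wordFun (stateWord τ c x) := by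
  refine ⟨FinTerm.subst Empty.elim (.word ((List.range x.1).map (fun i => Sym.out (τ (c i))) ++
    Sym.S :: x.2.map innerSym) (endTerm Sg Γ Empty)), ?_⟩
  rw [subst_word_toFun _ (subst_endTerm_toFun _)]
  · simp [stateWord]
  · intro g hg
    simp only [List.mem_append, List.mem_map, List.mem_cons] at hg
    rcases hg with ⟨i, -, rfl⟩ | rfl | ⟨d | d, -, rfl⟩ <;> rfl

theorem StateStep.stepAt {n : ℕ} {x y : ℕ × List (Γ ⊕ Γ)} (h : StateStep f c n x y)
    {t s : ITerm (Sym.ar (Sg := Sg) (Γ := Γ))} (ht : t.toFun = wordFun (stateWord τ c x))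
    (hs : s.toFun = wordFun (stateWord τ c y)) :
    StepAt (Rules f τ) (List.replicate n 0) t s := by
  obtain ⟨w, v, v', hv, rfl, hx, hy⟩ := h.exists_wordRule (τ := τ)
  exact hv.stepAt w (hx ▸ ht) (hy ▸ hs)

theorem innerSym_eq_bar {d : Γ ⊕ Γ} {b : Γ} (h : innerSym d = (Sym.bar b : Sym Sg Γ)) :
    d = .inr b := by
  cases d with
  | inl d => simp [innerSym, Sym.inp] at h
  | inr d => simpa [innerSym] using h

theorem innerSym_eq_inp {d : Γ ⊕ Γ} {b : Γ} (h : innerSym d = (Sym.inp b : Sym Sg Γ)) :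
    d = .inl b := by
  cases d with
  | inl d => exact congrArg _ (inp_injective h)
  | inr d => simp [innerSym, Sym.inp] at h

/-- This locates a redex behind the output `o`. The alphabets may overlap, so a plain letter could
also occur in the output; but each redex starts with `S` or a bar, which cannot. -/
theorem append_eq_append_of_head_not_mem {F : Type*} {o w x v : List F} {g : F} (hg : g ∉ o)
    (h : o ++ x = w ++ g :: v) : ∃ w', w = o ++ w' ∧ x = w' ++ g :: v := by
  rcases List.append_eq_append_iff.1 h with ⟨w', rfl, h'⟩ | ⟨w', rfl, h'⟩
  · exact ⟨w', rfl, h'⟩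
  · cases w' with
    | nil => exact ⟨[], by simp, by simpa using h'.symm⟩
    | cons y w' =>
      obtain ⟨rfl, -⟩ := List.cons.inj h'
      simp at hg

theorem exists_stateStep_of_bar {k : ℕ} {v : List (Γ ⊕ Γ)} {w v₁ v₂ : List (Sym Sg Γ)} {b : Γ}
    (hR : WordRule f τ (Sym.bar b :: v₁) v₂)
    (h : v.map innerSym ++ [Sym.E] = w ++ Sym.bar b :: v₁) :
    ∃ v', StateStep f c (k + 1 + w.length) (k, v) (k, v') ∧
      v'.map innerSym ++ [Sym.E] = w ++ v₂ := by
  have h1 : ∃ v₀ v₃, v = v₀ ++ .inr b :: v₃ ∧ v₀.map innerSym = w ∧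
      v₃.map innerSym ++ [Sym.E] = v₁ := by
    rcases List.append_eq_append_iff.1 h with ⟨w', hw, h'⟩ | ⟨w', hv, h'⟩
    · rcases w' with _ | ⟨y, w'⟩ <;> simp at h'
    · cases w' with
      | nil => simp at h'
      | cons y w' =>
        obtain ⟨rfl, rfl⟩ := List.cons.inj h'
        obtain ⟨v₀, v₃, rfl, rfl, h3⟩ := List.map_eq_append_iff.1 hv
        obtain ⟨d, v₃, rfl, hd, rfl⟩ := List.map_eq_cons_iff.1 h3
        exact ⟨v₀, v₃, by rw [innerSym_eq_bar hd], rfl, rfl⟩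
  obtain ⟨v₀, v₃, rfl, rfl, rfl⟩ := h1
  rw [List.length_map]
  generalize h2 : Sym.bar b :: (v₃.map innerSym ++ [Sym.E]) = z at hR
  cases hR with
  | emit d w => simp at h2
  | swap b' d w =>
    obtain ⟨hb, h3⟩ := List.cons.inj h2
    obtain rfl := Sym.bar.inj hb
    rcases v₃ with _ | ⟨e, v₃⟩
    · simp [Sym.inp] at h3
    · obtain ⟨he, rfl⟩ := List.cons.inj h3
      obtain rfl := innerSym_eq_inp he
      exact ⟨_, .swap k v₀ v₃ b d, by simp [innerSym]⟩
  | expand b' =>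
    obtain ⟨hb, h3⟩ := List.cons.inj h2
    obtain rfl := Sym.bar.inj hb
    obtain rfl : v₃ = [] := by simpa using congrArg List.length h3
    exact ⟨_, .expand k v₀ b, by simp [innerSym, Function.comp_def]⟩

theorem StepAt.exists_stateStep (hf : ∀ b, f b ≠ []) {a : Γ} {u : List Γ} (hu : u ≠ [])
    (hfa : f a = a :: u) {x : ℕ × List (Γ ⊕ Γ)} (hx : Valid f (pureMorphic f a) x) {p : List ℕ}
    {t s : ITerm (Sym.ar (Sg := Sg) (Γ := Γ))} (h : StepAt (Rules f τ) p t s)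
    (ht : t.toFun = wordFun (stateWord τ (pureMorphic f a) x)) :
    ∃ y, StateStep f (pureMorphic f a) p.length x y ∧
      s.toFun = wordFun (stateWord τ (pureMorphic f a) y) := by
  obtain ⟨w, v, v', hw, rfl, hR, hs⟩ := h.exists_wordRule ht
  obtain ⟨k, z⟩ := x
  rw [List.length_replicate, hs]
  have bar_case : ∀ b v₁, v = Sym.bar b :: v₁ →
      ∃ y, StateStep f (pureMorphic f a) w.length (k, z) y ∧
        wordFun (w ++ v') = wordFun (stateWord τ (pureMorphic f a) y) := by
    rintro b v₁ rfl
    obtain ⟨w', rfl, hw'⟩ := append_eq_append_of_head_not_mem (by simp [Sym.out]) hw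
    rcases w' with _ | ⟨y, w'⟩
    · simp at hw'
    obtain ⟨rfl, hw₂⟩ := List.cons.inj hw'
    obtain ⟨z', hz, hz'⟩ := exists_stateStep_of_bar (c := pureMorphic f a) (k := k) hR hw₂
    refine ⟨_, by convert hz using 1; simp; omega, ?_⟩
    simp [stateWord, hz']
  cases hR with
  | swap b d v => exact bar_case _ _ rfl
  | expand b => exact bar_case _ _ rfl
  | emit b v =>
    obtain ⟨w', rfl, hw'⟩ := append_eq_append_of_head_not_mem (by simp [Sym.out]) hw
    rcases w' with _ | ⟨y, w'⟩
    · obtain ⟨-, hw'⟩ := List.cons.inj hw'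
      rcases z with _ | ⟨d, z⟩
      · simp [Sym.inp] at hw'
      obtain ⟨hd, rfl⟩ := List.cons.inj hw'
      obtain rfl := innerSym_eq_inp hd
      obtain rfl : b = pureMorphic f a k := eq_pureMorphic_of_prefix hf hu hfa hx.2
      refine ⟨_, by simpa using StateStep.emit k z, ?_⟩
      simp [stateWord, List.range_succ, innerSym]
    -- Here the redex would start at a second `S`, but a state word contains only one.
    · obtain ⟨rfl, hw₂⟩ := List.cons.inj hw'
      have : (Sym.S : Sym Sg Γ) ∈ z.map innerSym ++ [Sym.E] := by
        rw [show z.map innerSym ++ [Sym.E] = _ from hw₂]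
        simp
      simp only [List.mem_append, List.mem_map, List.mem_singleton, reduceCtorEq, or_false] at this
      obtain ⟨d | d, -, hd⟩ := this <;> simp [innerSym, Sym.inp] at hd

/-- `t` is the word of a valid state with `k` emitted letters. -/
def Represents (f : Γ → List Γ) (τ : Γ → Sg) (a : Γ)
    (t : ITerm (Sym.ar (Sg := Sg) (Γ := Γ))) (k : ℕ) : Prop :=
  ∃ v, Valid f (pureMorphic f a) (k, v) ∧ t.toFun = wordFun (stateWord τ (pureMorphic f a) (k, v))

theorem Represents.step (hf : ∀ b, f b ≠ []) {a : Γ} {u : List Γ} (hu : u ≠ [])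
    (hfa : f a = a :: u) {k : ℕ} {p : List ℕ} {t s : ITerm (Sym.ar (Sg := Sg) (Γ := Γ))}
    (ht : Represents f τ a t k) (h : StepAt (Rules f τ) p t s) :
    p.length < (((List.range k).map (pureMorphic f a)).flatMap f).length + 1 ∧
      ∃ l, k ≤ l ∧ Represents f τ a s l := by
  obtain ⟨v, hv, htv⟩ := ht
  obtain ⟨⟨l, w⟩, hy, hs⟩ := h.exists_stateStep hf hu hfa hv htv
  exact ⟨hv.level_lt hf hy, l, hy.fst_le, w, hy.valid hv, hs⟩

theorem Represents.not_isNormalForm (hf : ∀ b, f b ≠ []) {a : Γ} {u : List Γ} (hu : u ≠ [])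
    (hfa : f a = a :: u) {k : ℕ} {t : ITerm (Sym.ar (Sg := Sg) (Γ := Γ))}
    (ht : Represents f τ a t k) : ¬ IsNormalForm (Rules f τ) t := by
  intro h
  obtain ⟨v, hv, ht⟩ := ht
  obtain ⟨n, y, hy⟩ := hv.exists_stateStep hf hu hfa
  obtain ⟨s, hs⟩ := exists_iTerm_stateWord τ (pureMorphic f a) y
  exact h _ _ (hy.stepAt ht hs)

theorem wordFun_stateWord_of_lt {x : ℕ × List (Γ ⊕ Γ)} {q : List ℕ} (hq : q.length < x.1) :
    wordFun (stateWord τ c x) q = (seqTerm Γ fun n => τ (c n)).toFun q := by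
  rw [wordFun_eq_ite, stateWord, List.getElem?_append_left (by simpa using hq)]
  simp [seqTerm, ITerm.ofSeq, hq]

theorem Represents.toFun_eq {a : Γ} {k : ℕ} {t : ITerm (Sym.ar (Sg := Sg) (Γ := Γ))}
    (ht : Represents f τ a t k) {q : List ℕ} (hq : q.length < k) :
    t.toFun q = (seqTerm Γ fun n => τ (pureMorphic f a n)).toFun q := by
  obtain ⟨v, -, ht⟩ := ht
  rw [ht]
  exact wordFun_stateWord_of_lt hq

theorem startTerm_toFun (τ : Γ → Sg) (f : Γ → List Γ) (a : Γ) (u : List Γ) :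
    (startTerm τ a u).toFun = wordFun (stateWord τ (pureMorphic f a) (1, u.map .inl)) := by
  have h : (startTerm τ a u).toFun =
      wordFun (Sym.out (τ a) :: Sym.S :: (u.map Sym.inp ++ [Sym.E])) :=
    subst_un_toFun <| subst_un_toFun <| subst_word_toFun ar_of_mem_map_inp (subst_endTerm_toFun _)
  rw [h]
  simp [stateWord, pureMorphic_zero, innerSym, Function.comp_def]

theorem valid_start {a : Γ} {u : List Γ} (hfa : f a = a :: u) :
    Valid f (pureMorphic f a) (1, u.map .inl) :=
  ⟨Nat.one_pos, by simp [pureMorphic_zero, evalWord_map_inl, hfa]⟩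

/-! ### Reductions -/

/-- Every left-hand side has `S` or a barred letter at its root, and the sequence contains neither.
-/
theorem isNormalForm_seqTerm (f : Γ → List Γ) (τ : Γ → Sg) (σ : ℕ → Sg) :
    IsNormalForm (Rules f τ) (seqTerm Γ σ) := by
  rintro p s ⟨l, r, θ, hR, hl, -, -⟩
  have h := hl []
  simp only [seqTerm, ITerm.ofSeq] at h
  split at h
  · cases hR <;> simp [FinTerm.un, FinTerm.subst, ITerm.app_nil, Sym.out] at h
  · cases hR <;> simp [FinTerm.un, FinTerm.subst, ITerm.app_nil] at h

theorem exists_represents_of_le (hf : ∀ b, f b ≠ []) {a : Γ} {u : List Γ} (hu : u ≠ [])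
    (hfa : f a = a :: u) {T : ℕ → ITerm (Sym.ar (Sg := Sg) (Γ := Γ))} {pos : ℕ → List ℕ}
    {M : ℕ} (hstep : ∀ m, m < M → StepAt (Rules f τ) (pos m) (T m) (T (m + 1)))
    {n k : ℕ} (hn : Represents f τ a (T n) k) {m : ℕ} (hnm : n ≤ m) (hm : m ≤ M) :
    ∃ l, k ≤ l ∧ Represents f τ a (T m) l := by
  induction m, hnm using Nat.le_induction with
  | base => exact ⟨k, le_rfl, hn⟩
  | succ m _ ih =>
    obtain ⟨l, hl, h⟩ := ih (by omega)
    obtain ⟨-, l', hl', h'⟩ := h.step hf hu hfa (hstep m (by omega))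
    exact ⟨l', hl.trans hl', h'⟩

theorem represents_startTerm {a : Γ} {u : List Γ} (hfa : f a = a :: u) (τ : Γ → Sg) :
    Represents f τ a (startTerm τ a u) 1 :=
  ⟨_, valid_start hfa, startTerm_toFun τ f a u⟩

theorem ConvergesTo.eq_seqTerm (hf : ∀ b, f b ≠ []) {a : Γ} {u : List Γ} (hu : u ≠ [])
    (hfa : f a = a :: u) {s : ITerm (Sym.ar (Sg := Sg) (Γ := Γ))}
    (h : ConvergesTo (Rules f τ) (startTerm τ a u) s) :
    s = seqTerm Γ fun n => τ (pureMorphic f a n) := by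
  obtain ⟨T, pos, h0, hstep, hlev, hlim⟩ := h
  have hT : ∀ {n k}, Represents f τ a (T n) k → ∀ m, n ≤ m →
      ∃ l, k ≤ l ∧ Represents f τ a (T m) l := fun hn m hnm =>
    exists_represents_of_le hf hu hfa (fun i _ => hstep i) hn hnm le_rfl
  have h1 : Represents f τ a (T 0) 1 := h0 ▸ represents_startTerm hfa τ
  have unbounded : ∀ K, ∃ n k, K < k ∧ Represents f τ a (T n) k := by
    by_contra! hK
    obtain ⟨K, hK⟩ := hK
    -- If at most `K` letters were ever emitted, every step would have level at most this length,
    -- whereas by convergence step `N` lies strictly deeper.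
    obtain ⟨N, hN⟩ := hlev (((List.range K).map (pureMorphic f a)).flatMap f).length
    obtain ⟨k, -, hk⟩ := hT h1 N (Nat.zero_le _)
    have h2 : k ≤ K := by
      by_contra! h2
      exact hK N k h2 hk
    have h3 := (hk.step hf hu hfa (hstep N)).1
    have h4 := length_flatMap_range_mono (f := f) (c := pureMorphic f a) h2
    have h5 := hN N le_rfl
    omega
  refine ITerm.ext (funext fun q => ?_)
  obtain ⟨N, hN⟩ := hlim q
  obtain ⟨n, k, hk, hn⟩ := unbounded q.length
  obtain ⟨l, hl, h2⟩ := hT hn (max n N) (le_max_left _ _)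
  rw [← hN _ (le_max_right n N), h2.toFun_eq (hk.trans_le hl)]

theorem exists_fst_gt {x : ℕ → ℕ × List (Γ ⊕ Γ)} {n : ℕ → ℕ}
    (h : ∀ i, StateStep f c (n i) (x i) (x (i + 1))) (K : ℕ) :
    ∃ N, ∀ i, N ≤ i → K < (x i).1 := by
  have hmono : Monotone fun i => (x i).1 := monotone_nat_of_le_succ fun i => (h i).fst_le
  -- Induction on a bound `m` for the potential: each step emits a letter or lowers the potential.
  have hgrow : ∀ m i, potential f (x i).2 < m → ∃ j, (x i).1 < (x j).1 := by
    intro m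
    induction m with
    | zero => simp
    | succ m ih =>
      intro i hi
      rcases (h i).fst_le.lt_or_eq with hlt | heq
      · exact ⟨_, hlt⟩
      · rw [heq]
        exact ih _ (by have := (h i).potential_lt heq; omega)
  suffices ∃ N, K < (x N).1 from
    this.imp fun N hN i hi => hN.trans_le (hmono hi)
  induction K with
  | zero =>
    obtain ⟨j, hj⟩ := hgrow _ 0 (Nat.lt_succ_self _)
    exact ⟨j, by omega⟩
  | succ K ih =>
    obtain ⟨N, hN⟩ := ih
    obtain ⟨j, hj⟩ := hgrow _ N (Nat.lt_succ_self _)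
    exact ⟨j, by omega⟩

/-- No strategy is needed: an arbitrary choice of a step from each valid state gives a converging
reduction. -/
theorem convergesTo_seqTerm (hf : ∀ b, f b ≠ []) {a : Γ} {u : List Γ} (hu : u ≠ [])
    (hfa : f a = a :: u) (τ : Γ → Sg) :
    ConvergesTo (Rules f τ) (startTerm τ a u) (seqTerm Γ fun n => τ (pureMorphic f a n)) := by
  choose lev next hnext using fun x : {x // Valid f (pureMorphic f a) x} =>
    x.2.exists_stateStep hf hu hfa
  choose term hterm using exists_iTerm_stateWord τ (pureMorphic f a)
  let g : ℕ → {x // Valid f (pureMorphic f a) x} := fun i =>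
    (fun x => ⟨next x, (hnext x).valid x.2⟩)^[i] ⟨_, valid_start hfa⟩
  have hg : ∀ i, StateStep f (pureMorphic f a) (lev (g i)) (g i).1 (g (i + 1)).1 := by
    intro i
    simp only [g, Function.iterate_succ_apply']
    exact hnext _
  have hlim := exists_fst_gt hg
  refine ⟨fun i => term (g i).1, fun i => List.replicate (lev (g i)) 0, ?_, fun i => ?_,
    fun K => ?_, fun q => ?_⟩
  · exact ITerm.ext ((hterm _).trans (startTerm_toFun τ f a u).symm)
  · exact (hg i).stepAt (hterm _) (hterm _)
  · obtain ⟨N, hN⟩ := hlim K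
    refine ⟨N, fun i hi => ?_⟩
    rw [List.length_replicate]
    exact (hN i hi).trans_le (hg i).le_level
  · obtain ⟨N, hN⟩ := hlim q.length
    refine ⟨N, fun i hi => ?_⟩
    simp only [hterm]
    exact wordFun_stateWord_of_lt (hN i hi)

theorem TransfiniteReduction.eq_seqTerm (hf : ∀ b, f b ≠ []) {a : Γ} {u : List Γ} (hu : u ≠ [])
    (hfa : f a = a :: u) {α : Ordinal.{0}} {s : ITerm (Sym.ar (Sg := Sg) (Γ := Γ))}
    (h : TransfiniteReduction (Rules f τ) α (startTerm τ a u) s)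
    (hs : IsNormalForm (Rules f τ) s) : s = seqTerm Γ fun n => τ (pureMorphic f a n) := by
  obtain ⟨T, pos, h0, rfl, hstep, hlim⟩ := h
  have hnat : ∀ n : ℕ, (n : Ordinal) < α →
      StepAt (Rules f τ) (pos n) (T n) (T ((n + 1 : ℕ) : Ordinal)) := by
    intro n hn
    simpa [Order.succ_eq_add_one] using hstep n hn
  -- Below `ω` the last term still represents a valid state and is reducible. From `ω` on, the
  -- initial segment of length `ω` is a converging reduction, and its limit `σ` allows no further
  -- step.
  rcases lt_or_ge α Ordinal.omega0 with hα | hα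
  · obtain ⟨m, rfl⟩ := Ordinal.lt_omega0.1 hα
    have h1 : Represents f τ a (T ((0 : ℕ) : Ordinal)) 1 := by
      simpa [h0] using represents_startTerm hfa τ
    obtain ⟨l, -, hl⟩ := exists_represents_of_le (T := fun n : ℕ => T n) (pos := fun n : ℕ => pos n)
      hf hu hfa (M := m) (fun n hn => hnat n (by exact_mod_cast hn)) h1 (Nat.zero_le m) le_rfl
    exact absurd hs (hl.not_isNormalForm hf hu hfa)
  · have hω : T Ordinal.omega0 = seqTerm Γ fun n => τ (pureMorphic f a n) := by
      obtain ⟨hlev, hval⟩ := hlim _ hα Ordinal.isSuccLimit_omega0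
      refine ConvergesTo.eq_seqTerm hf hu hfa ⟨fun n => T n, fun n => pos n, by simpa using h0,
        fun n => hnat n ((Ordinal.natCast_lt_omega0 n).trans_le hα), fun n => ?_, fun q => ?_⟩
      · obtain ⟨β, hβ, h⟩ := hlev n
        obtain ⟨N, rfl⟩ := Ordinal.lt_omega0.1 hβ
        exact ⟨N, fun k hk => h k (by exact_mod_cast hk) (Ordinal.natCast_lt_omega0 k)⟩
      · obtain ⟨β, hβ, h⟩ := hval q
        obtain ⟨N, rfl⟩ := Ordinal.lt_omega0.1 hβ
        exact ⟨N, fun k hk => h k (by exact_mod_cast hk) (Ordinal.natCast_lt_omega0 k)⟩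
    rcases hα.eq_or_lt with rfl | hlt
    · exact hω
    · have := hstep _ hlt
      rw [hω] at this
      exact absurd this (isNormalForm_seqTerm f τ _ _ _)

end Morphic

end MorphicRewriting

theorem mainTheorem4 {A : Type*} (Sg Γ : Set A) (hSg : Sg.Finite) (hΓ : Γ.Finite)
    (τ : Γ → Sg) (f : Γ → List Γ) (hf : ∀ b, f b ≠ [])
    (a : Γ) (u : List Γ) (hu : u ≠ []) (hfa : f a = a :: u)
    (σ : ℕ → Sg) (hσ : σ = fun n => τ (MorphicRewriting.pureMorphic f a n)) :
    MorphicRewriting.IsNormalForm (MorphicRewriting.Rules f τ)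
        (MorphicRewriting.seqTerm Γ σ) ∧
      MorphicRewriting.ConvergesTo (MorphicRewriting.Rules f τ)
        (MorphicRewriting.startTerm τ a u) (MorphicRewriting.seqTerm Γ σ) ∧
      (∀ s, MorphicRewriting.ConvergesTo (MorphicRewriting.Rules f τ)
          (MorphicRewriting.startTerm τ a u) s →
        s = MorphicRewriting.seqTerm Γ σ) ∧
      (∀ (α : Ordinal.{0}) s, MorphicRewriting.TransfiniteReduction (MorphicRewriting.Rules f τ) α
          (MorphicRewriting.startTerm τ a u) s →
        MorphicRewriting.IsNormalForm (MorphicRewriting.Rules f τ) s →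
        s = MorphicRewriting.seqTerm Γ σ) := by
  subst hσ
  exact ⟨MorphicRewriting.isNormalForm_seqTerm f τ _,
    MorphicRewriting.convergesTo_seqTerm hf hu hfa τ,
    fun _ h => h.eq_seqTerm hf hu hfa,
    fun _ _ h hs => h.eq_seqTerm hf hu hfa hs⟩
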